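/- Let $H$ be a real Hilbert space with inner product $\langle\cdot,\cdot\rangle$ and norm $\|\cdot\|$, and let $X$ (the space "$H^2$") be a real Banach space that is densely, injectively and compactly embedded in $H$. Let $V,W:X\to\mathbb R$ be functionals whose Fréchet derivatives are represented in $H$, $DV(u)v=\langle V'(u),v\rangle$ and $DW(u)v=\langle W'(u),v\rangle$, with $V':X\to H$ of class $C^1$ (so $V$ is $C^2$) and $W':X\to H$ continuous (so $W$ is $C^1$). Let $\Phi=\{\psi\in X: V'(\psi)=0\}$, and assume that for every $\psi\in\Phi$ the operator $V''(\psi):X\to H$ is Fredholm of index zero. Say that branching occurs at $\psi\in\Phi$ if $\psi$ is not isolated in $\Phi$ (in the topology of $X$), and assume $({\bf H_R})$: if branching occurs at $\psi\in\Phi$ and $k=\dim\ker V''(\psi)\ge 1$, then in a neighbourhood of $\psi$ the set $\Phi$ is an embedded $k$-dimensional $C^1$ submanifold of $X$. Call $h:[0,\infty)\to\mathbb R$ a *slow rate* if $h\in C^2$, $h>0$ and $h'<0$ on $[0,\infty)$, $h(t)\to0$ as $t\to\infty$, $\sqrt h\in L^1(\mathbb R_+)$ and $h'(t)/h(t)\to0$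 as $t\to\infty$. Then $h(t)=(1+t)^{-\alpha}$ is a slow rate for every $\alpha>2$, and the following holds for every slow rate $h$. Let $u:[0,\infty)\to X$ be an orbit of $$u_t=V'(u)+h(t)W'(u)\qquad(t>0),$$ that is, $u\in C((0,\infty);X)\cap C([0,\infty);H)$, and $u$ is differentiable in $H$ and satisfies the equation for all $t>0$. Suppose that the orbit is bounded in the following sense: either (a) $\{u(t):t\ge0\}$ is relatively compact in $X$, or (b) $\{u(t):t\ge0\}$ is bounded in $X$, $V$ and $W'$ are bounded on bounded subsets of $X$, and $V'$ is coercive on bounded sets: every bounded sequence $(v_n)$ in $X$ with $V'(v_n)\to0$ in $H$ has a subsequence that converges in $X$. Let $\omega(u)$ be the set of limits in $H$ of sequences $u(t_n)$ with $t_n\to\infty$. Then: 1. $\omega(u)\subseteq\Phi$; 2. there is $\psi\in\Phi$ with $\omega(u)=\{\psi\}$, and $u(t)\to\psi$ in $H$ as $t\to\infty$; 3. if branching occurs at this limit $\psi$, or if $\ker V''(\psi)=\{0\}$ (that is, unless $\psi$ is an isolated equilibrium with a non-trivial kernel), there is a constant $C$ such that $$\|u(t)-\psi\|\le C\int_{t-1}^{\infty}\sqrt{h(s)}\,ds\qquad\text{for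 all }t\ge1.$$ -/

import Mathlib

open Set Filter Topology MeasureTheory

namespace PerturbedGradient

section Rates

/-- The class of decay rates `h` on `[0, ∞)`: `h` is of class `C²`, positive, strictly decreasing
(`h' < 0`) to `0`, `√h` is integrable on `ℝ₊`, and the decay is slow: `h'(t) / h(t) → 0`. -/
structure IsSlowDecay (h : ℝ → ℝ) : Prop where
  contDiffOn : ContDiffOn ℝ 2 h (Ici 0)
  pos : ∀ t, 0 ≤ t → 0 < h t
  deriv_neg : ∀ t, 0 ≤ t → derivWithin h (Ici 0) t < 0
  tendsto_zero : Tendsto h atTop (𝓝 0)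
  integrable_sqrt : IntegrableOn (fun t => Real.sqrt (h t)) (Ici 0)
  slow : Tendsto (fun t => derivWithin h (Ici 0) t / h t) atTop (𝓝 0)

end Rates

section Systems

variable {H X : Type*} [NormedAddCommGroup H] [InnerProductSpace ℝ H]
  [NormedAddCommGroup X] [NormedSpace ℝ X]

/-- `G : X → H` is the Fréchet derivative of `V : X → ℝ`, represented through the inner product
of the larger space `H`, i.e. `DV(u) v = ⟪G u, j v⟫` for the embedding `j : X → H`. -/
def IsGradient (j : X →L[ℝ] H) (V : X → ℝ) (G : X → H) : Prop :=
  ∀ u, HasFDerivAt V ((innerSL ℝ (G u)).comp j) u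

/-- The set `Φ` of equilibria of `u_t = G u`. -/
def equilibria (G : X → H) : Set X := {ψ | G ψ = 0}

/-- A Fredholm operator of index zero. -/
def IsFredholmIndexZero (A : X →L[ℝ] H) : Prop :=
  A.IsFredholm ∧ Module.finrank ℝ A.ker = Module.finrank ℝ (H ⧸ A.range)

/-- Branching of equilibria occurs at `ψ`: it is a non-isolated point of the set of equilibria. -/
def IsBranchingPoint (G : X → H) (ψ : X) : Prop :=
  G ψ = 0 ∧ AccPt ψ (𝓟 (equilibria G))

/-- In a neighbourhood of `ψ`, the set `S` is an embedded `k`-dimensional `C¹` submanifold of `X`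
through `ψ`: a relatively open piece of `S` around `ψ` is the image of an open subset of `ℝᵏ`
under a `C¹` immersion that is a homeomorphism onto this image. -/
def IsLocalManifoldAt (k : ℕ) (S : Set X) (ψ : X) : Prop :=
  ∃ (O : Set X) (U : Set (EuclideanSpace ℝ (Fin k))) (φ : EuclideanSpace ℝ (Fin k) → X),
    IsOpen O ∧ ψ ∈ O ∧ IsOpen U ∧ ContDiffOn ℝ 1 φ U ∧
    (∀ μ ∈ U, Function.Injective (fderiv ℝ φ μ)) ∧
    IsEmbedding (U.domRestrict φ) ∧ φ '' U = S ∩ O ∧ ψ ∈ φ '' U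

/-- The resonance hypothesis: if branching occurs at an equilibrium `ψ` whose linearization
has a kernel of dimension `k ≥ 1`, then the set of equilibria is, near `ψ`,
a `k`-dimensional manifold. -/
def ResonanceHypothesis (G : X → H) : Prop :=
  ∀ ψ, IsBranchingPoint G ψ → 1 ≤ Module.finrank ℝ (fderiv ℝ G ψ).ker →
    IsLocalManifoldAt (Module.finrank ℝ (fderiv ℝ G ψ).ker) (equilibria G) ψ

/-- `u` is an orbit of `u_t = G u + h(t) K u`, `t > 0`: it is continuous with values in `X`
for `t > 0`, continuous with values in `H` up to `t = 0`, and it satisfies the equation in `H`. -/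
structure IsOrbit (j : X →L[ℝ] H) (G K : X → H) (h : ℝ → ℝ) (u : ℝ → X) : Prop where
  continuousOn : ContinuousOn u (Ioi 0)
  continuousOn_zero : ContinuousOn (fun t => j (u t)) (Ici 0)
  equation : ∀ t, 0 < t → HasDerivAt (fun s => j (u s)) (G (u t) + h t • K (u t)) t

/-- The `ω`-limit set of `u` in the topology of `H`. -/
def omegaLimitSet (j : X →L[ℝ] H) (u : ℝ → X) : Set H :=
  {y | ∃ s : ℕ → ℝ, Tendsto s atTop atTop ∧ Tendsto (fun n => j (u (s n))) atTop (𝓝 y)}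

/-- `f` maps bounded sets to bounded sets. -/
def BoundedOnBounded {E F : Type*} [Bornology E] [Bornology F] (f : E → F) : Prop :=
  ∀ B : Set E, Bornology.IsBounded B → Bornology.IsBounded (f '' B)

/-- Coercivity (compactness) of `G` on bounded sets: every `X`-bounded sequence along which
`G → 0` in `H` has a subsequence that converges in `X`. -/
def IsCoerciveOnBounded (G : X → H) : Prop :=
  ∀ v : ℕ → X, Bornology.IsBounded (range v) → Tendsto (fun n => G (v n)) atTop (𝓝 0) →
    ∃ (x : X) (n : ℕ → ℕ), StrictMono n ∧ Tendsto (fun i => v (n i)) atTop (𝓝 x)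

end Systems

end PerturbedGradient

/-! ### Decay rates and tails of `√h`. -/

namespace PerturbedGradient

/-! For `|W| ≤ M` along the orbit, the energy `e = -V(u) - h W(u) + M h` satisfies `e' ≤ -‖u_t‖²`,
so it decreases to a limit `l`. Short time shifts reach times of vanishing velocity, hence of
vanishing `V'`; coercivity or compactness makes every limit point an equilibrium with `V = -l`.

If a limit point `ψ` is an isolated equilibrium, the orbit cannot keep crossing a small sphere
around it, so it converges. Otherwise, and also when the kernel is trivial, `|V x - V ψ| ≤ C ‖V'
x‖²` holds near `ψ` (`IsGradient.lojasiewicz`): `V''(ψ)` is bounded below on a complement of its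
kernel, and the projection to the kernel is locally onto along the equilibria, so `x` lies within
`2K ‖V' x‖` of an equilibrium at level `V ψ`, where `V` is quadratically flat.

Along the orbit this reads `e - l ≤ C (‖u_t‖² + h)`. With `q = e - l + h` it yields `‖u_t‖ ≤ √h - c
(√q)'`, so the length is finite and the orbit is trapped (`tendsto_of_trapping`). As `h'/h → 0`, the
gap `e - l` is eventually `O(h)` (`exists_energy_le`), which gives the rate. -/

theorem hasDerivAt_one_add_rpow (β : ℝ) {t : ℝ} (ht : 0 ≤ t) :
    HasDerivAt (fun t : ℝ => (1 + t) ^ β) (β * (1 + t) ^ (β - 1)) t := by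
  have h1 : HasDerivAt (fun t : ℝ => 1 + t) 1 t := (hasDerivAt_id t).const_add 1
  have := h1.rpow_const (p := β) (Or.inl (by positivity))
  simpa using this

theorem isSlowDecay_rpow {α : ℝ} (hα : 2 < α) : IsSlowDecay (fun t => (1 + t) ^ (-α)) := by
  have hd : ∀ t : ℝ, 0 ≤ t →
      derivWithin (fun t : ℝ => (1 + t) ^ (-α)) (Ici 0) t = -α * (1 + t) ^ (-α - 1) := fun t ht =>
    (hasDerivAt_one_add_rpow (-α) ht).hasDerivWithinAt.derivWithin
      (uniqueDiffOn_Ici (0 : ℝ) t ht)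
  have hshift : Tendsto (fun t : ℝ => 1 + t) atTop atTop := tendsto_atTop_add_const_left _ _ tendsto_id
  refine ⟨?_, ?_, ?_, ?_, ?_, ?_⟩
  · refine ContDiffOn.rpow_const_of_ne (by fun_prop) fun t ht => ?_
    have : (0 : ℝ) ≤ t := ht
    positivity
  · intro t ht
    positivity
  · intro t ht
    rw [hd t ht]
    have : 0 < (1 + t) ^ (-α - 1) := by positivity
    nlinarith
  · exact (tendsto_rpow_neg_atTop (by linarith)).comp hshift
  · have h1 : IntegrableOn (fun t : ℝ => (t + 1) ^ (-α / 2)) (Ioi 0) :=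
      integrableOn_add_rpow_Ioi_of_lt (by linarith) (by norm_num)
    rw [integrableOn_Ici_iff_integrableOn_Ioi]
    refine h1.congr_fun (fun t ht => ?_) measurableSet_Ioi
    have ht' : (0 : ℝ) ≤ 1 + t := by have : (0 : ℝ) < t := ht; linarith
    change (t + 1) ^ (-α / 2) = √((1 + t) ^ (-α))
    rw [Real.sqrt_eq_rpow, ← Real.rpow_mul ht', add_comm]
    congr 1
    ring
  · have h1 : Tendsto (fun t : ℝ => -α * (1 + t)⁻¹) atTop (𝓝 (-α * 0)) :=
      (tendsto_inv_atTop_zero.comp hshift).const_mul _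
    rw [mul_zero] at h1
    refine h1.congr' ?_
    filter_upwards [eventually_ge_atTop 0] with t ht
    have ht' : (0 : ℝ) < 1 + t := by positivity
    rw [hd t ht, Real.rpow_sub ht', Real.rpow_one]
    have : (1 + t) ^ (-α) ≠ 0 := by positivity
    field_simp

namespace IsSlowDecay

variable {h : ℝ → ℝ}

theorem hasDerivAt (hh : IsSlowDecay h) {t : ℝ} (ht : 0 < t) :
    HasDerivAt h (derivWithin h (Ici 0) t) t :=
  ((hh.contDiffOn.differentiableOn (by norm_num) t ht.le).hasDerivWithinAt).hasDerivAt
    (Ici_mem_nhds ht)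

theorem continuousOn (hh : IsSlowDecay h) : ContinuousOn h (Ici 0) := hh.contDiffOn.continuousOn

theorem antitoneOn (hh : IsSlowDecay h) : AntitoneOn h (Ici 0) := by
  refine antitoneOn_of_deriv_nonpos (convex_Ici 0) hh.continuousOn ?_ ?_ <;> rw [interior_Ici]
  · exact fun t ht => (hh.hasDerivAt ht).differentiableAt.differentiableWithinAt
  · exact fun t ht => (hh.hasDerivAt ht).deriv.trans_le (hh.deriv_neg t (le_of_lt ht)).le

theorem continuousOn_sqrt (hh : IsSlowDecay h) : ContinuousOn (fun t => √(h t)) (Ici 0) :=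
  hh.continuousOn.sqrt

theorem intervalIntegrable_sqrt (hh : IsSlowDecay h) {a b : ℝ} (ha : 0 ≤ a) (hb : 0 ≤ b) :
    IntervalIntegrable (fun t => √(h t)) volume a b :=
  (hh.continuousOn_sqrt.mono fun _ ht => (le_min ha hb).trans ht.1).intervalIntegrable

theorem integrableOn_Ioi_sqrt (hh : IsSlowDecay h) {a : ℝ} (ha : 0 ≤ a) :
    IntegrableOn (fun t => √(h t)) (Ioi a) :=
  hh.integrable_sqrt.mono_set fun _ ht => ha.trans (le_of_lt ht)

theorem hasDerivAt_integral_sqrt (hh : IsSlowDecay h) {a t : ℝ} (ha : 0 ≤ a) (ht : 0 < t) :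
    HasDerivAt (fun x => ∫ s in a..x, √(h s)) (√(h t)) t :=
  intervalIntegral.integral_hasDerivAt_right (hh.intervalIntegrable_sqrt ha ht.le)
    (hh.continuousOn_sqrt.mono Ioi_subset_Ici_self |>.stronglyMeasurableAtFilter isOpen_Ioi t ht)
    (hh.continuousOn_sqrt.continuousAt (Ici_mem_nhds ht))

theorem interval_add_tail (hh : IsSlowDecay h) {a b : ℝ} (ha : 0 ≤ a) (hab : a ≤ b) :
    (∫ s in a..b, √(h s)) + ∫ s in Ioi b, √(h s) = ∫ s in Ioi a, √(h s) :=
  intervalIntegral.integral_interval_add_Ioi (hh.integrableOn_Ioi_sqrt ha)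
    (hh.integrableOn_Ioi_sqrt (ha.trans hab))

theorem tail_nonneg (h : ℝ → ℝ) (a : ℝ) : 0 ≤ ∫ s in Ioi a, √(h s) :=
  integral_nonneg fun _ => Real.sqrt_nonneg _

theorem interval_le_tail (hh : IsSlowDecay h) {a b : ℝ} (ha : 0 ≤ a) (hab : a ≤ b) :
    ∫ s in a..b, √(h s) ≤ ∫ s in Ioi a, √(h s) := by
  linarith [hh.interval_add_tail ha hab, tail_nonneg h b]

theorem tail_anti (hh : IsSlowDecay h) {a b : ℝ} (ha : 0 ≤ a) (hab : a ≤ b) :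
    ∫ s in Ioi b, √(h s) ≤ ∫ s in Ioi a, √(h s) := by
  have : 0 ≤ ∫ s in a..b, √(h s) :=
    intervalIntegral.integral_nonneg hab fun _ _ => Real.sqrt_nonneg _
  linarith [hh.interval_add_tail ha hab]

/-- Since `h` decreases, `√(h t)` is at most the mean of `√h` over `[t - 1, t]`. This is the origin
of the `t - 1` in the final rate. -/
theorem sqrt_le_tail (hh : IsSlowDecay h) {t : ℝ} (ht : 1 ≤ t) :
    √(h t) ≤ ∫ s in Ioi (t - 1), √(h s) := by
  have h0 : 0 ≤ t - 1 := by linarith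
  have h1 : ∫ _ in (t - 1)..t, √(h t) ≤ ∫ s in (t - 1)..t, √(h s) := by
    refine intervalIntegral.integral_mono_on (by linarith) (by simp)
      (hh.intervalIntegrable_sqrt h0 (by linarith)) fun s hs => Real.sqrt_le_sqrt ?_
    exact hh.antitoneOn (h0.trans hs.1) (by simp; linarith) hs.2
  rw [intervalIntegral.integral_const] at h1
  have h2 : √(h t) ≤ ∫ s in (t - 1)..t, √(h s) := by simpa using h1
  exact h2.trans (hh.interval_le_tail h0 (by linarith))

theorem tail_pos (hh : IsSlowDecay h) {a : ℝ} (ha : 0 ≤ a) : 0 < ∫ s in Ioi a, √(h s) := by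
  have h1 := hh.sqrt_le_tail (t := a + 1) (by linarith)
  rw [add_sub_cancel_right] at h1
  exact (Real.sqrt_pos.2 (hh.pos _ (by linarith))).trans_le h1

theorem tendsto_tail (hh : IsSlowDecay h) :
    Tendsto (fun t => ∫ s in Ioi t, √(h s)) atTop (𝓝 0) := by
  have h1 := intervalIntegral_tendsto_integral_Ioi 0 (hh.integrableOn_Ioi_sqrt le_rfl) tendsto_id
  have h2 := h1.const_sub (∫ s in Ioi 0, √(h s))
  rw [sub_self] at h2
  refine h2.congr' ?_
  filter_upwards [eventually_ge_atTop 0] with t ht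
  have := hh.interval_add_tail le_rfl ht
  simp only [id]
  linarith

end IsSlowDecay

/-! ### Chain rule for gradients represented in `H`. -/

section ChainRule

variable {H X : Type*} [NormedAddCommGroup H] [InnerProductSpace ℝ H]
  [NormedAddCommGroup X] [NormedSpace ℝ X] {j : X →L[ℝ] H} {V : X → ℝ} {G : X → H}

theorem IsGradient.exists_sub_eq_inner (hV : IsGradient j V G) {s : Set X} (hs : Convex ℝ s)
    {x y : X} (hx : x ∈ s) (hy : y ∈ s) :
    ∃ z ∈ s, V y - V x = inner ℝ (G z) (j (y - x)) := by
  obtain ⟨z, hz, hzz⟩ := domain_mvt (fun x _ => (hV x).hasFDerivWithinAt) hs hx hy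
  exact ⟨z, hs.segment_subset hx hy hz, by simpa using hzz⟩

theorem IsGradient.continuous (hV : IsGradient j V G) : Continuous V :=
  continuous_iff_continuousAt.2 fun x => (hV x).continuousAt

/-- The chain rule along a curve that is continuous in `X`, but differentiable only in `H`. -/
theorem IsGradient.hasDerivAt_comp (hV : IsGradient j V G) (hG : Continuous G) {u : ℝ → X}
    {u' : H} {t : ℝ} (hu : ContinuousAt u t) (hju : HasDerivAt (fun s => j (u s)) u' t) :
    HasDerivAt (fun s => V (u s)) (inner ℝ (G (u t)) u') t := by
  -- By the mean value theorem this remainder is `⟪G z - G (u t), j (u s) - j (u t)⟫` with `z` close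
  -- to `u t` in `X`, so it is small relative to the increment in `H`, not only to that in `X`.
  have h1 : (fun s => V (u s) - V (u t) - inner ℝ (G (u t)) (j (u s) - j (u t)))
      =o[𝓝 t] fun s => j (u s) - j (u t) := by
    refine Asymptotics.isLittleO_iff.2 fun c hc => ?_
    obtain ⟨δ, hδ, hball⟩ := Metric.continuousAt_iff.1 (hG.continuousAt (x := u t)) c hc
    filter_upwards [hu (Metric.ball_mem_nhds _ hδ)] with s hs
    obtain ⟨z, hz, hzV⟩ := hV.exists_sub_eq_inner (convex_ball (u t) δ)
      (Metric.mem_ball_self hδ) hs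
    rw [hzV, map_sub, ← inner_sub_left]
    refine (norm_inner_le_norm _ _).trans ?_
    gcongr
    rw [← dist_eq_norm]
    exact (hball hz).le
  have h2 := h1.trans_isBigO hju.isBigO_sub
  have h3 : HasDerivAt (fun s => inner ℝ (G (u t)) (j (u s))) (inner ℝ (G (u t)) u') t := by
    simpa using (hasDerivAt_const t (G (u t))).inner ℝ hju
  rw [hasDerivAt_iff_isLittleO] at h3 ⊢
  refine (h2.add h3).congr_left fun s => ?_
  rw [inner_sub_right]
  simp only [smul_eq_mul]
  ring

end ChainRule

/-! ### The Łojasiewicz–Simon inequality. -/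

section Lojasiewicz

variable {H X : Type*} [NormedAddCommGroup H] [InnerProductSpace ℝ H]
  [NormedAddCommGroup X] [NormedSpace ℝ X] {j : X →L[ℝ] H} {V : X → ℝ} {G : X → H} {ψ : X}

/-- The linearization of a gradient is symmetric. -/
theorem IsGradient.inner_hasFDerivAt_comm (hV : IsGradient j V G) {A : X →L[ℝ] H}
    (hA : HasFDerivAt G A ψ) (v w : X) : inner ℝ (A v) (j w) = inner ℝ (A w) (j v) := by
  let B : H →L[ℝ] H →L[ℝ] ℝ := (isBoundedBilinearMap_inner (𝕜 := ℝ)).toContinuousLinearMap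
  let T : H →L[ℝ] X →L[ℝ] ℝ := ((ContinuousLinearMap.compL ℝ X H ℝ).flip j).comp B
  have hT : ∀ y : H, (innerSL ℝ y).comp j = T y := fun y => by ext x; rfl
  have h1 : ∀ u, HasFDerivAt V (T (G u)) u := fun u => hT (G u) ▸ hV u
  have h2 : HasFDerivAt (fun u => T (G u)) (T.comp A) ψ := T.hasFDerivAt.comp ψ hA
  exact second_derivative_symmetric h1 h2 v w

/-- By symmetry `⟪A x, j n⟫ = ⟪A n, j x⟫ = 0`: the range of `A` is orthogonal to the image of its
kernel. -/
theorem IsGradient.range_inf_map_ker (hV : IsGradient j V G) {A : X →L[ℝ] H}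
    (hA : HasFDerivAt G A ψ) {x n : X} (hn : A n = 0) (hx : A x = j n) : j n = 0 := by
  have h1 := hV.inner_hasFDerivAt_comm hA x n
  rw [hn, hx, inner_zero_left] at h1
  exact inner_self_eq_zero.1 h1

/-- A Fredholm linearization of index zero is bounded below on each complement of its kernel. -/
theorem IsGradient.exists_norm_le_of_proj_eq_zero [CompleteSpace H] [CompleteSpace X]
    (hj : Function.Injective j) (hV : IsGradient j V G) {A : X →L[ℝ] H}
    (hA : HasFDerivAt G A ψ) (hFred : IsFredholmIndexZero A)
    (P : X →L[ℝ] A.ker) (hP : ∀ x : A.ker, P x = x) :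
    ∃ K : ℝ, 0 < K ∧ ∀ v, P v = 0 → ‖v‖ ≤ K * ‖A v‖ := by
  obtain ⟨hF, hind⟩ := hFred
  have := hF.finite_ker
  have hcok : FiniteDimensional ℝ (H ⧸ A.range) := hF.finite_coker
  -- `L` agrees with `A` where `P` vanishes, and it is a bijection, so the bound on its inverse is
  -- the required estimate.
  let L : X →L[ℝ] H := A + j.comp (A.ker.subtypeL.comp P)
  have hL : ∀ v, L v = A v + j (P v) := fun v => rfl
  have hker : L.ker = ⊥ := by
    refine (Submodule.eq_bot_iff _).2 fun v hv => ?_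
    have hv0 : A v + j (P v) = 0 := hv
    have h1 : A (-v) = j (P v) := by rw [map_neg]; exact neg_eq_of_add_eq_zero_right hv0
    have h2 : j (P v) = 0 := hV.range_inf_map_ker hA (P v).2 h1
    have h3 : A v = 0 := by rwa [h2, add_zero] at hv0
    have h4 : ((P v : A.ker) : X) = 0 := hj (by rw [h2, map_zero])
    have h5 := hP ⟨v, h3⟩
    have h6 : ((P v : A.ker) : X) = v := congrArg Subtype.val h5
    rw [← h6, h4]
  -- Orthogonality makes `q` injective; index zero makes the dimensions equal, hence `q` bijective,
  -- so `j` of the kernel and the range of `A` span `H`.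
  let q : A.ker →ₗ[ℝ] H ⧸ A.range :=
    A.range.mkQ ∘ₗ (j : X →ₗ[ℝ] H) ∘ₗ A.ker.subtype
  have hq : Function.Injective q := by
    refine (injective_iff_map_eq_zero q).2 fun n hn => ?_
    have h1 : j n ∈ A.range := (Submodule.Quotient.mk_eq_zero _).1 hn
    obtain ⟨x, hx⟩ := h1
    have h2 := hV.range_inf_map_ker hA n.2 hx
    exact Subtype.ext (hj (by rw [h2]; simp))
  have hqs : Function.Surjective q :=
    (LinearMap.injective_iff_surjective_of_finrank_eq_finrank hind).1 hq
  have hrange : L.range = ⊤ := by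
    refine LinearMap.range_eq_top.2 fun y => ?_
    obtain ⟨n, hn⟩ := hqs (A.range.mkQ y)
    have h1 : j n - y ∈ A.range := (Submodule.Quotient.eq _).1 hn
    obtain ⟨x, hx⟩ := h1
    have hx' : A x = j n - y := hx
    -- `A` sends this point to `y - j n`, and `P x` cancels the kernel part of `-x`, so `P` sends it
    -- to `n`.
    refine ⟨-x + (P x : X) + n, ?_⟩
    have hn0 : A (n : X) = 0 := n.2
    have hPx : A ((P x : A.ker) : X) = 0 := (P x).2
    change A (-x + (P x : X) + n) + j (P (-x + (P x : X) + n)) = y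
    simp only [map_add, map_neg, hn0, hPx, hx', hP]
    simp
  let e := ContinuousLinearEquiv.ofBijective L hker hrange
  refine ⟨‖(e.symm : H →L[ℝ] X)‖ + 1, by positivity, fun v hv => ?_⟩
  have h1 : e v = A v := by
    change A v + j (P v) = A v
    simp [hv]
  calc ‖v‖ = ‖e.symm (A v)‖ := by rw [← h1, e.symm_apply_apply]
    _ ≤ ‖(e.symm : H →L[ℝ] X)‖ * ‖A v‖ := (e.symm : H →L[ℝ] X).le_opNorm _
    _ ≤ _ := by gcongr; linarith

/-- Near `ψ`, the gradient controls the distance of two points with the same projection to the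
kernel of the linearization. -/
theorem eventually_norm_sub_le {A : X →L[ℝ] H} (hA : HasStrictFDerivAt G A ψ)
    {E : Type*} [NormedAddCommGroup E] [NormedSpace ℝ E] {P : X →L[ℝ] E} {K : ℝ} (hK : 0 < K)
    (hKP : ∀ v, P v = 0 → ‖v‖ ≤ K * ‖A v‖) :
    ∀ᶠ p : X × X in 𝓝 (ψ, ψ), P p.1 = P p.2 → ‖p.1 - p.2‖ ≤ 2 * K * ‖G p.1 - G p.2‖ := by
  -- With this constant the linearization error costs half of `‖p.1 - p.2‖`, which is absorbed on
  -- the left.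
  have h1 := hA.isLittleO.def (show 0 < (2 * K)⁻¹ by positivity)
  filter_upwards [h1] with p hp hPp
  have h2 : ‖p.1 - p.2‖ ≤ K * ‖A (p.1 - p.2)‖ := hKP _ (by rw [map_sub, hPp, sub_self])
  have h3 : ‖A (p.1 - p.2)‖ ≤ ‖G p.1 - G p.2‖ + (2 * K)⁻¹ * ‖p.1 - p.2‖ := by
    have := norm_sub_norm_le (A (p.1 - p.2)) (G p.1 - G p.2)
    rw [norm_sub_rev (A (p.1 - p.2))] at this
    linarith
  have h4 : K * ((2 * K)⁻¹ * ‖p.1 - p.2‖) = ‖p.1 - p.2‖ / 2 := by field_simp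
  nlinarith

/-- Every point near `ψ` has the same projection to the kernel of the linearization as some
equilibrium near `ψ` on the energy level of `ψ`, if the equilibria form a manifold of the
dimension of the kernel. -/
theorem IsGradient.eventually_exists_equilibrium (hV : IsGradient j V G)
    {A : X →L[ℝ] H} (hA : HasFDerivAt G A ψ) [FiniteDimensional ℝ A.ker]
    (P : X →L[ℝ] A.ker) (hP : ∀ x : A.ker, P x = x)
    (hM : IsLocalManifoldAt (Module.finrank ℝ A.ker) (equilibria G) ψ) {S : Set X}
    (hS : S ∈ 𝓝 ψ) :
    ∀ᶠ x in 𝓝 ψ, ∃ w ∈ S, G w = 0 ∧ P w = P x ∧ V w = V ψ := by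
  obtain ⟨O, U, φ, -, -, hU, hφ, himm, -, himg, m, hmU, rfl⟩ := hM
  have hφ0 : ∀ y ∈ U, G (φ y) = 0 := fun y hy => (himg.subset (mem_image_of_mem φ hy)).1
  have hφd : ∀ y ∈ U, HasStrictFDerivAt φ (fderiv ℝ φ y) y := fun y hy =>
    (hφ.contDiffAt (hU.mem_nhds hy)).hasStrictFDerivAt one_ne_zero
  have hAφ : ∀ v, A (fderiv ℝ φ m v) = 0 := by
    have h1 : HasFDerivAt (fun y => G (φ y)) (A.comp (fderiv ℝ φ m)) m :=
      hA.comp m (hφd m hmU).hasFDerivAt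
    have h2 : HasFDerivAt (fun y => G (φ y)) (0 : _ →L[ℝ] H) m :=
      (hasFDerivAt_const (0 : H) m).congr_of_eventuallyEq <| by
        filter_upwards [hU.mem_nhds hmU] with y hy using hφ0 y hy
    intro v
    exact congrArg (fun T : _ →L[ℝ] H => T v) (h1.unique h2)
  -- The tangent map is injective into the kernel, where `P` is the identity; equality of dimensions
  -- makes the composition onto, so `P ∘ φ` is locally open at `m`.
  have hsurj : (P.comp (fderiv ℝ φ m)).range = ⊤ := by
    refine LinearMap.range_eq_top.2 ?_
    refine (LinearMap.injective_iff_surjective_of_finrank_eq_finrank (by simp)).1 ?_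
    intro v w hvw
    refine himm m hmU ?_
    have h1 : P (fderiv ℝ φ m v) = P (fderiv ℝ φ m w) := hvw
    have h2 := hP ⟨_, hAφ v⟩
    have h3 := hP ⟨_, hAφ w⟩
    simp only at h2 h3
    rw [h2, h3] at h1
    exact congrArg Subtype.val h1
  have hmap : map (fun y => P (φ y)) (𝓝 m) = 𝓝 (P (φ m)) :=
    (P.hasStrictFDerivAt.comp m (hφd m hmU)).map_nhds_eq_of_surj hsurj
  obtain ⟨r, hr, hrU⟩ := Metric.isOpen_iff.1 hU m hmU
  have hconst : ∀ y ∈ Metric.ball m r, V (φ y) = V (φ m) := by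
    intro y hy
    refine (convex_ball m r).is_const_of_fderivWithin_eq_zero (𝕜 := ℝ) (f := fun y => V (φ y))
      ?_ ?_ hy (Metric.mem_ball_self hr)
    · exact fun z hz => ((hV (φ z)).comp z (hφd z (hrU hz)).hasFDerivAt).differentiableAt
        |>.differentiableWithinAt
    · intro z hz
      rw [fderivWithin_of_isOpen Metric.isOpen_ball hz]
      have h1 := ((hV (φ z)).comp z (hφd z (hrU hz)).hasFDerivAt).fderiv
      rw [hφ0 z (hrU hz)] at h1
      refine h1.trans ?_
      ext v
      simp
  have hnear : φ ⁻¹' S ∩ Metric.ball m r ∈ 𝓝 m :=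
    inter_mem ((hφd m hmU).continuousAt hS) (Metric.ball_mem_nhds m hr)
  have hNmem : (fun y => P (φ y)) '' (φ ⁻¹' S ∩ Metric.ball m r) ∈ 𝓝 (P (φ m)) :=
    hmap ▸ image_mem_map hnear
  filter_upwards [P.continuous.continuousAt hNmem] with x hx
  obtain ⟨y, ⟨hyS, hyr⟩, hyx⟩ := hx
  exact ⟨φ y, hyS, hφ0 y (hrU hyr), hyx, hconst y hyr⟩

/-- The Łojasiewicz–Simon inequality with the optimal exponent `1/2`, near an equilibrium with
trivial kernel or on a manifold of equilibria of the dimension of the kernel. -/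
theorem IsGradient.lojasiewicz [CompleteSpace H] [CompleteSpace X]
    (hj : Function.Injective j) (hV : IsGradient j V G) (hG : ContDiff ℝ 1 G) (hψ : G ψ = 0)
    (hFred : IsFredholmIndexZero (fderiv ℝ G ψ))
    (hM : (fderiv ℝ G ψ).ker = ⊥ ∨
      IsLocalManifoldAt (Module.finrank ℝ (fderiv ℝ G ψ).ker) (equilibria G) ψ) :
    ∃ C : ℝ, 0 ≤ C ∧ ∀ᶠ x in 𝓝 ψ, |V x - V ψ| ≤ C * ‖G x‖ ^ 2 := by
  have hs : HasStrictFDerivAt G (fderiv ℝ G ψ) ψ :=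
    hG.contDiffAt.hasStrictFDerivAt one_ne_zero
  have := hFred.1.finite_ker
  obtain ⟨P, hP⟩ := hFred.1.closedComplemented_ker
  obtain ⟨K, hK, hKP⟩ := hV.exists_norm_le_of_proj_eq_zero hj hs.hasFDerivAt hFred P hP
  obtain ⟨S₁, hS₁, hS₁P⟩ := eventually_prod_self_iff'.1
    (nhds_prod_eq (x := ψ) (y := ψ) ▸ eventually_norm_sub_le hs hK hKP)
  obtain ⟨M, S₂, hS₂, hlip⟩ := hs.exists_lipschitzOnWith
  obtain ⟨r, hr, hball⟩ := Metric.mem_nhds_iff.1 (inter_mem hS₁ hS₂)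
  have hw : ∀ᶠ x in 𝓝 ψ, ∃ w ∈ Metric.ball ψ r, G w = 0 ∧ P w = P x ∧ V w = V ψ := by
    rcases hM with hM | hM
    · refine Eventually.of_forall fun x => ⟨ψ, Metric.mem_ball_self hr, hψ, ?_, rfl⟩
      have : ∀ y : (fderiv ℝ G ψ).ker, y = 0 := fun y =>
        Subtype.ext ((Submodule.eq_bot_iff _).1 hM y y.2)
      rw [this (P ψ), this (P x)]
    · exact hV.eventually_exists_equilibrium hs.hasFDerivAt P hP hM
        (Metric.ball_mem_nhds ψ hr)
  refine ⟨M * ‖j‖ * (2 * K) ^ 2, by positivity, ?_⟩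
  filter_upwards [hw, Metric.ball_mem_nhds ψ hr] with x ⟨w, hwr, hw0, hPw, hVw⟩ hx
  have h1 : ‖x - w‖ ≤ 2 * K * ‖G x‖ := by
    have := hS₁P x (hball hx).1 w (hball hwr).1 hPw.symm
    simpa [hw0] using this
  -- `G w = 0` and the Lipschitz bound make `‖G z‖` linear in `‖x - w‖`, so the energy difference is
  -- quadratic in it.
  obtain ⟨z, hz, hzV⟩ := hV.exists_sub_eq_inner
    ((convex_segment w x)) (left_mem_segment ℝ w x) (right_mem_segment ℝ w x)
  have hzball : z ∈ Metric.ball ψ r := (convex_ball ψ r).segment_subset hwr hx hz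
  have h2 : ‖G z‖ ≤ M * ‖x - w‖ := by
    have h3 := hlip.dist_le_mul z (hball hzball).2 w (hball hwr).2
    rw [dist_eq_norm, hw0, sub_zero, dist_eq_norm] at h3
    refine h3.trans ?_
    gcongr
    rw [← dist_eq_norm, ← dist_eq_norm, dist_comm x w, ← dist_add_dist_of_mem_segment hz,
      dist_comm z w]
    linarith [dist_nonneg (x := z) (y := x)]
  rw [← hVw, hzV]
  calc |inner ℝ (G z) (j (x - w))| ≤ ‖G z‖ * ‖j (x - w)‖ := abs_real_inner_le_norm _ _
    _ ≤ (M * ‖x - w‖) * (‖j‖ * ‖x - w‖) := by gcongr; exact j.le_opNorm _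
    _ = M * ‖j‖ * ‖x - w‖ ^ 2 := by ring
    _ ≤ M * ‖j‖ * (2 * K * ‖G x‖) ^ 2 := by gcongr
    _ = M * ‖j‖ * (2 * K) ^ 2 * ‖G x‖ ^ 2 := by ring

end Lojasiewicz

/-! ### Dissipative curves: trapping and decay of the energy gap. -/

/-- A curve `f` with velocity `v`, and an energy `e` with derivative `e'` that decreases along `f`
at least at the rate `‖v‖²`. -/
structure IsDissipative {H : Type*} [NormedAddCommGroup H] [NormedSpace ℝ H]
    (f v : ℝ → H) (e e' : ℝ → ℝ) : Prop where
  hasDerivAt : ∀ t, 0 < t → HasDerivAt f (v t) t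
  hasDerivAt_energy : ∀ t, 0 < t → HasDerivAt e (e' t) t
  deriv_le : ∀ t, 0 < t → e' t ≤ -‖v t‖ ^ 2

/-- A curve in a compact set converges to each isolated point of its `ω`-limit set. -/
theorem tendsto_of_isolated {E : Type*} [PseudoMetricSpace E] {f : ℝ → E} {K : Set E} {y : E}
    (hf : ContinuousOn f (Ici 0)) (hK : IsCompact K) (hfK : ∀ t, 0 ≤ t → f t ∈ K)
    {s : ℕ → ℝ} (hs : Tendsto s atTop atTop) (hsy : Tendsto (fun n => f (s n)) atTop (𝓝 y))
    {r : ℝ} (hr : 0 < r)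
    (hiso : ∀ (z : E) (s : ℕ → ℝ), Tendsto s atTop atTop →
      Tendsto (fun n => f (s n)) atTop (𝓝 z) → dist z y < r → dist z y = 0) :
    Tendsto f atTop (𝓝 y) := by
  by_contra hcon
  rw [Metric.tendsto_atTop] at hcon
  push Not at hcon
  obtain ⟨ε, hε, hfar⟩ := hcon
  -- The curve returns near `y` and later leaves the `ε`-ball, so it meets the sphere of radius `ρ ≤
  -- ε` at arbitrarily late times. A limit point on this sphere contradicts isolation, as `0 < ρ <
  -- r`.
  let ρ := min ε (r / 2)
  have hρ : 0 < ρ := lt_min hε (half_pos hr)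
  have hhit : ∀ n : ℕ, ∃ t : ℝ, (n : ℝ) ≤ t ∧ dist (f t) y = ρ := by
    intro n
    obtain ⟨m, hm1, hm2⟩ := ((hs.eventually_ge_atTop (n : ℝ)).and
      (hsy (Metric.ball_mem_nhds y hρ))).exists
    obtain ⟨b, hb, hfb⟩ := hfar (s m)
    have h0 : (0 : ℝ) ≤ s m := (Nat.cast_nonneg n).trans hm1
    have hcont : ContinuousOn (fun t => dist (f t) y) (Icc (s m) b) :=
      (continuous_id.dist continuous_const).comp_continuousOn (hf.mono fun t ht => h0.trans ht.1)
    obtain ⟨t, ht, hty⟩ := intermediate_value_Icc hb hcont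
      ⟨le_of_lt hm2, (min_le_left _ _).trans hfb⟩
    exact ⟨t, hm1.trans ht.1, hty⟩
  choose t htn htρ using hhit
  obtain ⟨z, -, φ, hφ, hz⟩ := hK.tendsto_subseq fun n =>
    hfK (t n) ((Nat.cast_nonneg n).trans (htn n))
  have h1 : Tendsto (fun n => t (φ n)) atTop atTop :=
    (tendsto_atTop_mono htn tendsto_natCast_atTop_atTop).comp hφ.tendsto_atTop
  have h2 : dist z y = ρ := by
    have h3 : Tendsto (fun n => dist (f (t (φ n))) y) atTop (𝓝 (dist z y)) :=
      Tendsto.dist hz tendsto_const_nhds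
    simp only [htρ] at h3
    exact tendsto_nhds_unique h3 tendsto_const_nhds
  have h4 := hiso z _ h1 hz (h2 ▸ (min_le_right ε (r / 2)).trans_lt (half_lt_self hr))
  exact hρ.ne' (h2.symm.trans h4)

namespace IsDissipative

variable {H : Type*} [NormedAddCommGroup H] [NormedSpace ℝ H] {f v : ℝ → H} {e e' : ℝ → ℝ}

theorem continuousOn (hd : IsDissipative f v e e') : ContinuousOn f (Ioi 0) :=
  fun t ht => (hd.hasDerivAt t ht).continuousAt.continuousWithinAt

theorem deriv_nonpos (hd : IsDissipative f v e e') {t : ℝ} (ht : 0 < t) : e' t ≤ 0 :=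
  (hd.deriv_le t ht).trans (neg_nonpos.2 (sq_nonneg _))

theorem antitoneOn (hd : IsDissipative f v e e') : AntitoneOn e (Ioi 0) := by
  refine antitoneOn_of_deriv_nonpos (convex_Ioi 0)
    (fun t ht => (hd.hasDerivAt_energy t ht).continuousAt.continuousWithinAt) ?_ ?_ <;>
    rw [interior_Ioi]
  · exact fun t ht => (hd.hasDerivAt_energy t ht).differentiableAt.differentiableWithinAt
  · exact fun t ht => (hd.hasDerivAt_energy t ht).deriv.trans_le (hd.deriv_nonpos ht)

theorem exists_tendsto (hd : IsDissipative f v e e') {m : ℝ} (hm : ∀ t, 0 < t → m ≤ e t) :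
    ∃ l, Tendsto e atTop (𝓝 l) ∧ ∀ t, 0 < t → l ≤ e t := by
  have hpos : ∀ t : ℝ, 0 < max t 1 := fun t => lt_max_of_lt_right one_pos
  have hanti : Antitone fun t => e (max t 1) := fun a b hab =>
    hd.antitoneOn (hpos a) (hpos b) (max_le_max_right 1 hab)
  have hbdd : BddBelow (range fun t => e (max t 1)) :=
    ⟨m, by rintro _ ⟨t, rfl⟩; exact hm _ (hpos t)⟩
  have hlim := tendsto_atTop_ciInf hanti hbdd
  have hlim' : Tendsto e atTop (𝓝 (⨅ t, e (max t 1))) := by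
    refine hlim.congr' ?_
    filter_upwards [eventually_ge_atTop 1] with t ht
    rw [max_eq_left ht]
  refine ⟨_, hlim', fun t ht => le_of_tendsto hlim' ?_⟩
  filter_upwards [eventually_ge_atTop t] with b hb
  exact hd.antitoneOn ht (ht.trans_le hb) hb

/-- Bounding the velocity by the derivative of `B` bounds the displacement by the increment
of `B`. -/
theorem norm_sub_le (hd : IsDissipative f v e e') {B B' : ℝ → ℝ} {a b : ℝ} (ha : 0 < a)
    (hab : a ≤ b) (hB : ∀ t, 0 < t → HasDerivAt B (B' t) t)
    (hle : ∀ t, a ≤ t → t < b → ‖v t‖ ≤ B' t) : ‖f b - f a‖ ≤ B b - B a := by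
  refine image_norm_le_of_norm_deriv_right_le_deriv_boundary' (f := fun t => f t - f a) (f' := v)
    (B := fun t => B t - B a) (B' := B') (a := a) (b := b) ?_ ?_ (by simp) ?_ ?_ ?_
    (right_mem_Icc.2 hab)
  · exact (hd.continuousOn.mono fun t ht => ha.trans_le ht.1).sub continuousOn_const
  · exact fun t ht => ((hd.hasDerivAt t (ha.trans_le ht.1)).sub_const _).hasDerivWithinAt
  · exact fun t ht => ((hB t (ha.trans_le ht.1)).sub_const _).continuousAt.continuousWithinAt
  · exact fun t ht => ((hB t (ha.trans_le ht.1)).sub_const _).hasDerivWithinAt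
  · exact fun t ht => hle t ht.1 ht.2

/-- Young's inequality `2‖v‖ ≤ η + ‖v‖²/η ≤ η - e'/η`, integrated over a time of length at most one,
replaces Cauchy–Schwarz and needs no integrability of `v`. -/
theorem norm_sub_le_of_energy (hd : IsDissipative f v e e') {a b η : ℝ} (ha : 0 < a)
    (hab : a ≤ b) (hb : b ≤ a + 1) (hη : 0 < η) (he : e a - e b ≤ η ^ 2) : ‖f b - f a‖ ≤ η := by
  have h1 := hd.norm_sub_le (B := fun t => (η * t - e t / η) / 2)
    (B' := fun t => (η * 1 - e' t / η) / 2) ha hab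
    (fun t ht => (((hasDerivAt_id t).const_mul η).sub
      ((hd.hasDerivAt_energy t ht).div_const η)).div_const 2) ?_
  · have h2 : (e a - e b) / η ≤ η := by
      rw [div_le_iff₀ hη]; nlinarith
    rw [sub_div] at h2
    nlinarith
  · intro t hat _
    have h3 := hd.deriv_le t (ha.trans_le hat)
    have h4 : ‖v t‖ ^ 2 / η ≤ -e' t / η := by gcongr; linarith
    have h5 : 2 * ‖v t‖ ≤ η + ‖v t‖ ^ 2 / η := by
      rw [← sub_nonneg]
      have : η + ‖v t‖ ^ 2 / η - 2 * ‖v t‖ = (‖v t‖ - η) ^ 2 / η := by field_simp; ring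
      rw [this]
      positivity
    rw [neg_div] at h4
    linarith

/-- Each time can be shifted by at most one to a time of small velocity and small displacement. -/
theorem exists_shift (hd : IsDissipative f v e e') {l : ℝ} (hl : Tendsto e atTop (𝓝 l))
    {s : ℕ → ℝ} (hs : Tendsto s atTop atTop) :
    ∃ τ : ℕ → ℝ, (∀ n, s n ≤ τ n) ∧ Tendsto (fun n => v (τ n)) atTop (𝓝 0) ∧
      Tendsto (fun n => f (τ n) - f (s n)) atTop (𝓝 0) := by
  have hex : ∀ n, ∃ τ, s n ≤ τ ∧ τ ≤ s n + 1 ∧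
      (0 < s n → ‖v τ‖ ^ 2 ≤ e (s n) - e (s n + 1)) := by
    intro n
    by_cases h0 : 0 < s n
    · obtain ⟨τ, hτ, hτe⟩ := exists_hasDerivAt_eq_slope e e' (lt_add_one (s n))
        (fun t ht => (hd.hasDerivAt_energy t (h0.trans_le ht.1)).continuousAt.continuousWithinAt)
        (fun t ht => hd.hasDerivAt_energy t (h0.trans ht.1))
      refine ⟨τ, hτ.1.le, hτ.2.le, fun _ => ?_⟩
      have h1 := hd.deriv_le τ (h0.trans hτ.1)
      rw [hτe, add_sub_cancel_left, div_one] at h1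
      linarith
    · exact ⟨s n, le_rfl, by linarith, fun h => absurd h h0⟩
  choose τ h1 h2 h3 using hex
  have hgap : Tendsto (fun n => e (s n) - e (s n + 1)) atTop (𝓝 0) := by
    have := (hl.comp hs).sub (hl.comp (tendsto_atTop_add_const_right _ 1 hs))
    rwa [sub_self] at this
  have hpos := hs.eventually_gt_atTop 0
  refine ⟨τ, h1, ?_, ?_⟩
  · rw [tendsto_zero_iff_norm_tendsto_zero]
    have h4 : Tendsto (fun n => √(e (s n) - e (s n + 1))) atTop (𝓝 0) := by
      simpa using hgap.sqrt
    refine squeeze_zero' (Eventually.of_forall fun _ => norm_nonneg _) ?_ h4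
    filter_upwards [hpos] with n hn
    exact Real.le_sqrt_of_sq_le (h3 n hn)
  · rw [Metric.tendsto_nhds]
    intro ε hε
    have h5 : ∀ᶠ n in atTop, e (s n) - e (s n + 1) < (ε / 2) ^ 2 :=
      hgap.eventually_lt_const (by positivity)
    filter_upwards [hpos, h5] with n hn hgn
    have h6 := hd.norm_sub_le_of_energy hn (h1 n) (h2 n) (half_pos hε) (by
      have := hd.antitoneOn (hn.trans_le (h1 n)) (show 0 < s n + 1 by linarith) (h2 n)
      linarith)
    rw [dist_zero_right]
    linarith

variable {h : ℝ → ℝ} {l C : ℝ}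

/-- The summand `h` keeps the radicand positive even where the energy gap vanishes. -/
theorem hasDerivAt_sqrt (hd : IsDissipative f v e e') (hh : IsSlowDecay h)
    (hl : ∀ t, 0 < t → l ≤ e t) {t : ℝ} (ht : 0 < t) :
    HasDerivAt (fun t => √(e t - l + h t))
      ((e' t + derivWithin h (Ici 0) t) / (2 * √(e t - l + h t))) t := by
  refine (((hd.hasDerivAt_energy t ht).sub_const l).add (hh.hasDerivAt ht)).sqrt ?_
  have := hl t ht
  have := hh.pos t ht.le
  exact ne_of_gt (by simp only [Pi.add_apply]; linarith)

/-- Let `q = e - l + h`, so `-q' ≥ ‖v‖²`. If `‖v‖² ≤ h`, the term `√h` suffices. Otherwise `q ≤ (2C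
+ 1)‖v‖²`, and `-q'/√q` controls `‖v‖`. -/
theorem norm_velocity_le (hd : IsDissipative f v e e') (hh : IsSlowDecay h)
    (hl : ∀ t, 0 < t → l ≤ e t) (hC : 0 ≤ C) {t : ℝ} (ht : 0 < t)
    (hle : e t - l ≤ C * (‖v t‖ ^ 2 + h t)) :
    ‖v t‖ ≤ √(h t) - 2 * √(2 * C + 1) *
      ((e' t + derivWithin h (Ici 0) t) / (2 * √(e t - l + h t))) := by
  have hpos := hh.pos t ht.le
  have hq : 0 < e t - l + h t := by linarith [hl t ht]
  have hs : 0 < √(e t - l + h t) := Real.sqrt_pos.2 hq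
  have hdle : ‖v t‖ ^ 2 ≤ -(e' t + derivWithin h (Ici 0) t) := by
    linarith [hd.deriv_le t ht, hh.deriv_neg t ht.le]
  have hrw : -(2 * √(2 * C + 1) *
      ((e' t + derivWithin h (Ici 0) t) / (2 * √(e t - l + h t)))) =
      √(2 * C + 1) * -(e' t + derivWithin h (Ici 0) t) / √(e t - l + h t) := by
    field_simp
  rw [sub_eq_add_neg, hrw]
  rcases le_or_gt (‖v t‖ ^ 2) (h t) with hcase | hcase
  · have h1 : ‖v t‖ ≤ √(h t) := Real.le_sqrt_of_sq_le hcase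
    have h2 : 0 ≤ √(2 * C + 1) * -(e' t + derivWithin h (Ici 0) t) / √(e t - l + h t) :=
      div_nonneg (mul_nonneg (Real.sqrt_nonneg _) ((sq_nonneg _).trans hdle)) hs.le
    linarith
  · have h1 : √(e t - l + h t) ≤ √(2 * C + 1) * ‖v t‖ := by
      rw [← Real.sqrt_sq (norm_nonneg (v t)), ← Real.sqrt_mul (by linarith)]
      exact Real.sqrt_le_sqrt (by nlinarith)
    have h2 : ‖v t‖ ≤
        √(2 * C + 1) * -(e' t + derivWithin h (Ici 0) t) / √(e t - l + h t) := by
      rw [le_div_iff₀ hs]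
      calc ‖v t‖ * √(e t - l + h t) ≤ ‖v t‖ * (√(2 * C + 1) * ‖v t‖) := by gcongr
        _ = √(2 * C + 1) * ‖v t‖ ^ 2 := by ring
        _ ≤ _ := by gcongr
    linarith [Real.sqrt_nonneg (h t)]

theorem norm_sub_le_tail (hd : IsDissipative f v e e') (hh : IsSlowDecay h)
    (hl : ∀ t, 0 < t → l ≤ e t) (hC : 0 ≤ C) {a b : ℝ} (ha : 0 < a) (hab : a ≤ b)
    (hle : ∀ t, a ≤ t → t < b → e t - l ≤ C * (‖v t‖ ^ 2 + h t)) :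
    ‖f b - f a‖ ≤ (∫ s in Ioi a, √(h s)) + 2 * √(2 * C + 1) * √(e a - l + h a) := by
  have h1 := hd.norm_sub_le
    (B := fun t => (∫ s in a..t, √(h s)) - 2 * √(2 * C + 1) * √(e t - l + h t)) ha hab
    (fun t ht => (hh.hasDerivAt_integral_sqrt ha.le ht).sub
      ((hd.hasDerivAt_sqrt hh hl ht).const_mul _))
    (fun t hat htb => hd.norm_velocity_le hh hl hC (ha.trans_le hat) (hle t hat htb))
  simp only [intervalIntegral.integral_same] at h1
  have h2 : 0 ≤ 2 * √(2 * C + 1) * √(e b - l + h b) := by positivity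
  linarith [hh.interval_le_tail ha.le hab]

/-- If the energy gap is controlled by the velocity near a limit point `p` of the curve, then the
curve converges to `p`, at a rate given by the energy gap. -/
theorem tendsto_of_trapping (hd : IsDissipative f v e e') (hh : IsSlowDecay h)
    (hl : ∀ t, 0 < t → l ≤ e t) (hlim : Tendsto e atTop (𝓝 l)) (hC : 0 ≤ C) {p : H}
    {s : ℕ → ℝ} (hs : Tendsto s atTop atTop) (hsp : Tendsto (fun n => f (s n)) atTop (𝓝 p))
    {δ : ℝ} (hδ : 0 < δ)
    (hle : ∀ t, 0 < t → ‖f t - p‖ < δ → e t - l ≤ C * (‖v t‖ ^ 2 + h t)) :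
    Tendsto f atTop (𝓝 p) ∧ ∃ T, 0 < T ∧ ∀ t, T ≤ t → ‖f t - p‖ < δ ∧
      ‖f t - p‖ ≤ (∫ s in Ioi t, √(h s)) + 2 * √(2 * C + 1) * √(e t - l + h t) := by
  set R : ℝ → ℝ := fun t => (∫ s in Ioi t, √(h s)) + 2 * √(2 * C + 1) * √(e t - l + h t) with hRdef
  have hR : Tendsto R atTop (𝓝 0) := by
    have h1 : Tendsto (fun t => √(e t - l + h t)) atTop (𝓝 √(l - l + 0)) :=
      ((hlim.sub_const l).add hh.tendsto_zero).sqrt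
    have h2 := hh.tendsto_tail.add (h1.const_mul (2 * √(2 * C + 1)))
    simpa using h2
  have hclose : ∀ ε > 0, ∀ T : ℝ, ∃ a, T ≤ a ∧ 0 < a ∧ ‖f a - p‖ < ε ∧ R a < ε := by
    intro ε hε T
    have h1 : ∀ᶠ n in atTop, ‖f (s n) - p‖ < ε := by
      filter_upwards [hsp (Metric.ball_mem_nhds p hε)] with n hn
      rw [← dist_eq_norm]
      exact hn
    obtain ⟨n, hn1, hn2, hn3, hn4⟩ := ((hs.eventually_ge_atTop T).and
      ((hs.eventually_gt_atTop 0).and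
        (h1.and ((hR.comp hs).eventually_lt_const hε)))).exists
    exact ⟨s n, hn1, hn2, hn3, hn4⟩
  obtain ⟨a, -, ha, hfa, hRa⟩ := hclose (δ / 2) (half_pos hδ) 0
  -- Up to the first exit time `sInf S` the gap estimate holds, so the curve moves by at most `R a <
  -- δ / 2` from a point within `δ / 2` of `p`: it cannot exit.
  have htrap : ∀ t, a ≤ t → ‖f t - p‖ < δ := by
    by_contra! hcon
    let S : Set ℝ := Ici a ∩ (fun t => ‖f t - p‖) ⁻¹' Ici δ
    have hSne : S.Nonempty := hcon
    have hSc : IsClosed S :=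
      ContinuousOn.preimage_isClosed_of_isClosed
        (((hd.continuousOn.mono fun t ht => ha.trans_le ht).sub continuousOn_const).norm)
        isClosed_Ici isClosed_Ici
    have hSb : BddBelow S := ⟨a, fun t ht => ht.1⟩
    have hmem := hSc.csInf_mem hSne hSb
    have h1 := hd.norm_sub_le_tail hh hl hC ha hmem.1 fun t hat htb =>
      hle t (ha.trans_le hat) <| lt_of_not_ge fun hge => (notMem_of_lt_csInf htb hSb) ⟨hat, hge⟩
    have h2 : δ ≤ ‖f (sInf S) - p‖ := hmem.2
    have h3 : ‖f (sInf S) - p‖ ≤ ‖f (sInf S) - f a‖ + ‖f a - p‖ :=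
      norm_sub_le_norm_sub_add_norm_sub ..
    simp only [hRdef] at hRa
    linarith
  have hmove : ∀ b c, a ≤ b → b ≤ c → ‖f c - f b‖ ≤ R b := fun b c hab hbc =>
    hd.norm_sub_le_tail hh hl hC (ha.trans_le hab) hbc fun t hbt _ =>
      hle t (ha.trans_le (hab.trans hbt)) (htrap t (hab.trans hbt))
  have htend : Tendsto f atTop (𝓝 p) := by
    rw [Metric.tendsto_atTop]
    intro ε hε
    obtain ⟨b, hab, -, hfb, hRb⟩ := hclose (ε / 2) (half_pos hε) a
    refine ⟨b, fun t ht => ?_⟩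
    have h1 := hmove b t hab ht
    have h3 : ‖f t - p‖ ≤ ‖f t - f b‖ + ‖f b - p‖ := norm_sub_le_norm_sub_add_norm_sub ..
    rw [dist_eq_norm]
    linarith
  refine ⟨htend, a, ha, fun t ht => ⟨htrap t ht, ?_⟩⟩
  have h1 : Tendsto (fun c => ‖f c - f t‖) atTop (𝓝 ‖p - f t‖) := (htend.sub_const _).norm
  rw [norm_sub_rev]
  refine le_of_tendsto h1 ?_
  filter_upwards [eventually_ge_atTop t] with c hc using hmove t c ht hc

/-- If the energy gap is controlled by the velocity, then it decays at least as fast as `h`. -/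
theorem exists_energy_le (hd : IsDissipative f v e e') (hh : IsSlowDecay h)
    (hl : ∀ t, 0 < t → l ≤ e t) (hC : 0 < C) {T : ℝ} (hT : 0 < T)
    (hle : ∀ t, T ≤ t → e t - l ≤ C * (‖v t‖ ^ 2 + h t)) :
    ∃ D T', 0 ≤ D ∧ T ≤ T' ∧ ∀ t, T' ≤ t → e t - l ≤ D * h t := by
  -- The gap is damped at rate `1 / C`; slow decay of `h` spends at most half of it, leaving `r' ≤ 1
  -- - r / (2C)` for the ratio `r`. The function `m` below carries the integrating factor.
  obtain ⟨T₀, hT₀⟩ := eventually_atTop.1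
    (hh.slow.eventually_const_lt (show -(1 / (2 * C)) < 0 by simp only [neg_lt_zero]; positivity))
  let T' := max T T₀
  have hT' : 0 < T' := hT.trans_le (le_max_left _ _)
  let r : ℝ → ℝ := fun t => (e t - l) / h t
  let r' : ℝ → ℝ := fun t =>
    (e' t * h t - (e t - l) * derivWithin h (Ici 0) t) / h t ^ 2
  let m : ℝ → ℝ := fun t => (r t - 2 * C) * Real.exp (t / (2 * C))
  have hr : ∀ t, 0 < t → HasDerivAt r (r' t) t := fun t ht =>
    ((hd.hasDerivAt_energy t ht).sub_const l).div (hh.hasDerivAt ht) (hh.pos t ht.le).ne'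
  have hr' : ∀ t, T' ≤ t → r' t ≤ 1 - r t / (2 * C) := by
    intro t ht
    have ht0 : 0 < t := hT'.trans_le ht
    have hp := hh.pos t ht0.le
    have h1 := hT₀ t ((le_max_right _ _).trans ht)
    have h2 := hd.deriv_le t ht0
    have h3 := hle t ((le_max_left _ _).trans ht)
    have h4 : 0 ≤ r t := div_nonneg (by linarith [hl t ht0]) hp.le
    have h5 : r' t = e' t / h t + r t * -(derivWithin h (Ici 0) t / h t) := by
      simp only [r, r']
      field_simp
      ring
    have h6 : r t * -(derivWithin h (Ici 0) t / h t) ≤ r t * (1 / (2 * C)) :=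
      mul_le_mul_of_nonneg_left (by linarith) h4
    have h7 : e' t / h t ≤ 1 - r t / C := by
      rw [div_le_iff₀ hp]
      have h8 : (1 - r t / C) * h t = h t - (e t - l) / C := by
        simp only [r]
        field_simp
      have h9 : (e t - l) / C ≤ ‖v t‖ ^ 2 + h t := by
        rw [div_le_iff₀ hC]; linarith
      rw [h8]
      linarith
    have h10 : r t / C = r t / (2 * C) + r t * (1 / (2 * C)) := by field_simp; ring
    rw [h5]
    linarith
  have hm : ∀ t, 0 < t → HasDerivAt m
      (r' t * Real.exp (t / (2 * C)) +
        (r t - 2 * C) * (Real.exp (t / (2 * C)) * (1 / (2 * C)))) t := fun t ht =>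
    ((hr t ht).sub_const _).mul (((hasDerivAt_id t).div_const _).exp)
  have hanti : AntitoneOn m (Ici T') := by
    refine antitoneOn_of_deriv_nonpos (convex_Ici T')
      (fun t ht => (hm t (hT'.trans_le ht)).continuousAt.continuousWithinAt) ?_ ?_ <;>
      rw [interior_Ici]
    · exact fun t ht => (hm t (hT'.trans ht)).differentiableAt.differentiableWithinAt
    · intro t ht
      rw [(hm t (hT'.trans ht)).deriv]
      have h1 := hr' t (le_of_lt ht)
      have h2 : r' t * Real.exp (t / (2 * C)) +
          (r t - 2 * C) * (Real.exp (t / (2 * C)) * (1 / (2 * C))) =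
          (r' t - (1 - r t / (2 * C))) * Real.exp (t / (2 * C)) := by
        field_simp
        ring
      rw [h2]
      exact mul_nonpos_of_nonpos_of_nonneg (by linarith) (Real.exp_pos _).le
  refine ⟨|r T' - 2 * C| + 2 * C, T', by positivity, le_max_left _ _, fun t ht => ?_⟩
  have hp := hh.pos t (hT'.trans_le ht).le
  rw [← div_le_iff₀ hp]
  have h1 : m t ≤ m T' := hanti self_mem_Ici ht ht
  have h2 : m T' ≤ |r T' - 2 * C| * Real.exp (t / (2 * C)) := by
    have h3 : Real.exp (T' / (2 * C)) ≤ Real.exp (t / (2 * C)) := by gcongr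
    exact (mul_le_mul_of_nonneg_right (le_abs_self _) (Real.exp_pos _).le).trans
      (mul_le_mul_of_nonneg_left h3 (abs_nonneg _))
  have h4 : r t - 2 * C ≤ |r T' - 2 * C| :=
    le_of_mul_le_mul_right (h1.trans h2) (Real.exp_pos _)
  change r t ≤ _
  linarith

end IsDissipative

/-! ### From orbits to dissipative curves. -/

section Orbits

variable {H X : Type*} [NormedAddCommGroup H] [InnerProductSpace ℝ H]
  [NormedAddCommGroup X] [NormedSpace ℝ X] {j : X →L[ℝ] H} {V W : X → ℝ} {G K : X → H}
  {B : Set X} {ψ : X} {h : ℝ → ℝ} {u : ℝ → X}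

/-- The common consequences of the two notions of a bounded orbit, for the closure `B` of the
orbit. -/
structure IsAdmissibleSet (j : X →L[ℝ] H) (V W : X → ℝ) (G K : X → H) (B : Set X) : Prop where
  isClosed : IsClosed B
  exists_subseq : ∀ v : ℕ → X, (∀ n, v n ∈ B) → Tendsto (fun n => G (v n)) atTop (𝓝 0) →
    ∃ (x : X) (n : ℕ → ℕ), StrictMono n ∧ Tendsto (fun i => v (n i)) atTop (𝓝 x)
  bounded_energy : ∃ M, ∀ x ∈ B, |V x| ≤ M
  bounded_perturbation : ∃ M, ∀ x ∈ B, |W x| ≤ M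
  bounded_gradient : ∃ M, ∀ x ∈ B, ‖K x‖ ≤ M
  isCompact_image : IsCompact (closure (j '' B))

theorem isAdmissibleSet_of_isCompact (hB : IsCompact B) (hV : IsGradient j V G)
    (hW : IsGradient j W K) (hK : Continuous K) : IsAdmissibleSet j V W G K B where
  isClosed := hB.isClosed
  exists_subseq v hv _ := by
    obtain ⟨x, -, n, hn, hx⟩ := hB.tendsto_subseq hv
    exact ⟨x, n, hn, hx⟩
  bounded_energy := hB.exists_bound_of_continuousOn hV.continuous.continuousOn
  bounded_perturbation := hB.exists_bound_of_continuousOn hW.continuous.continuousOn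
  bounded_gradient := hB.exists_bound_of_continuousOn hK.continuousOn
  isCompact_image := (hB.image j.continuous).closure

theorem BoundedOnBounded.exists_norm_le {E F : Type*} [SeminormedAddCommGroup E]
    [SeminormedAddCommGroup F] {f : E → F} (hf : BoundedOnBounded f) {S : Set E}
    (hS : Bornology.IsBounded S) : ∃ M, ∀ x ∈ S, ‖f x‖ ≤ M := by
  obtain ⟨M, hM⟩ := isBounded_iff_forall_norm_le.1 (hf S hS)
  exact ⟨M, fun x hx => hM _ (mem_image_of_mem f hx)⟩

theorem isAdmissibleSet_of_isBounded (hj : IsCompactOperator j) (hB : Bornology.IsBounded B)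
    (hBc : IsClosed B) (hW : IsGradient j W K) (hG : IsCoerciveOnBounded G)
    (hVb : BoundedOnBounded V) (hKb : BoundedOnBounded K) : IsAdmissibleSet j V W G K B where
  isClosed := hBc
  exists_subseq v hv hv0 := hG v (hB.subset (range_subset_iff.2 hv)) hv0
  bounded_energy := hVb.exists_norm_le hB
  -- The bound on `W` comes from that on `K` over a ball, by the mean value theorem from `0`.
  bounded_perturbation := by
    obtain ⟨R, hR, hBR⟩ := hB.subset_closedBall_lt 0 0
    obtain ⟨M, hM⟩ := hKb.exists_norm_le (Metric.isBounded_closedBall (x := (0 : X)) (r := R))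
    refine ⟨|W 0| + M * (‖j‖ * R), fun x hx => ?_⟩
    obtain ⟨z, hz, hzW⟩ := hW.exists_sub_eq_inner (convex_closedBall (0 : X) R)
      (Metric.mem_closedBall_self hR.le) (hBR hx)
    rw [sub_zero] at hzW
    have hM0 : 0 ≤ M := (norm_nonneg _).trans (hM z hz)
    have h1 : ‖j x‖ ≤ ‖j‖ * R :=
      (j.le_opNorm x).trans (by gcongr; exact mem_closedBall_zero_iff.1 (hBR hx))
    have h2 : |W x - W 0| ≤ M * (‖j‖ * R) := by
      rw [hzW]
      exact (abs_real_inner_le_norm _ _).trans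
        (mul_le_mul (hM z hz) h1 (norm_nonneg _) hM0)
    have h3 := abs_add_le (W 0) (W x - W 0)
    rw [add_sub_cancel] at h3
    linarith
  bounded_gradient := hKb.exists_norm_le hB
  isCompact_image := hj.isCompact_closure_image_of_bounded hB

/-- On an admissible set, a property that holds near `ψ` in `X` holds at the points that are close
to `ψ` in `H` and have a small gradient. -/
theorem IsAdmissibleSet.exists_of_eventually (hB : IsAdmissibleSet j V W G K B)
    (hj : Function.Injective j) {Q : X → Prop} (hQ : ∀ᶠ x in 𝓝 ψ, Q x) :
    ∃ r > 0, ∀ x ∈ B, ‖G x‖ < r → ‖j x - j ψ‖ < r → Q x := by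
  by_contra! hcon
  choose v hvB hvG hvj hvQ using fun n : ℕ => hcon (1 / ((n : ℝ) + 1)) (by positivity)
  have hlim := tendsto_one_div_add_atTop_nhds_zero_nat (𝕜 := ℝ)
  have hG0 : Tendsto (fun n => G (v n)) atTop (𝓝 0) :=
    squeeze_zero_norm (fun n => (hvG n).le) hlim
  have hj0 : Tendsto (fun n => j (v n)) atTop (𝓝 (j ψ)) :=
    tendsto_iff_norm_sub_tendsto_zero.2
      (squeeze_zero (fun _ => norm_nonneg _) (fun n => (hvj n).le) hlim)
  -- Small gradients upgrade convergence in `H` to convergence in `X` along a subsequence;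
  -- injectivity of `j` identifies the limit.
  obtain ⟨x, n, hn, hx⟩ := hB.exists_subseq v hvB hG0
  have hxψ : x = ψ := hj <| tendsto_nhds_unique ((j.continuous.tendsto x).comp hx)
    (hj0.comp hn.tendsto_atTop)
  rw [hxψ] at hx
  obtain ⟨i, hi⟩ := (hx.eventually hQ).exists
  exact hvQ _ hi

/-- Passes from neighbourhoods in `X` to neighbourhoods in `H`: a small gradient forces closeness in
`X`, and where `‖G x‖ ≥ r` the bounded energy gives the inequality outright. -/
theorem IsAdmissibleSet.lojasiewicz (hB : IsAdmissibleSet j V W G K B)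
    (hj : Function.Injective j) {C : ℝ} (hC : 0 ≤ C)
    (hloc : ∀ᶠ x in 𝓝 ψ, |V x - V ψ| ≤ C * ‖G x‖ ^ 2) :
    ∃ C' : ℝ, 0 ≤ C' ∧ ∃ δ > 0, ∀ x ∈ B, ‖j x - j ψ‖ < δ → |V x - V ψ| ≤ C' * ‖G x‖ ^ 2 := by
  obtain ⟨r, hr, hrB⟩ := hB.exists_of_eventually hj hloc
  obtain ⟨M, hM⟩ := hB.bounded_energy
  refine ⟨C + (|M| + |V ψ|) / r ^ 2, by positivity, r, hr, fun x hx hxr => ?_⟩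
  rcases lt_or_ge ‖G x‖ r with hG | hG
  · refine (hrB x hx hG hxr).trans ?_
    gcongr
    exact le_add_of_nonneg_right (by positivity)
  · have h1 : |V x - V ψ| ≤ |M| + |V ψ| :=
      (abs_sub _ _).trans (by linarith [hM x hx, le_abs_self M])
    have h2 : r ^ 2 ≤ ‖G x‖ ^ 2 := by gcongr
    calc |V x - V ψ| ≤ (|M| + |V ψ|) / r ^ 2 * r ^ 2 := by
          rwa [div_mul_cancel₀ _ (by positivity)]
      _ ≤ (|M| + |V ψ|) / r ^ 2 * ‖G x‖ ^ 2 := by gcongr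
      _ ≤ _ := by gcongr; linarith

theorem IsAdmissibleSet.exists_isolated (hB : IsAdmissibleSet j V W G K B)
    (hj : Function.Injective j) (hψ : ¬ AccPt ψ (𝓟 (equilibria G))) :
    ∃ r > 0, ∀ x ∈ B, G x = 0 → ‖j x - j ψ‖ < r → x = ψ := by
  rw [accPt_iff_frequently, not_frequently] at hψ
  obtain ⟨r, hr, hrB⟩ := hB.exists_of_eventually hj hψ
  refine ⟨r, hr, fun x hx hG hxr => ?_⟩
  by_contra hne
  exact hrB x hx (by simpa [hG] using hr) hxr ⟨hne, hG⟩

/-- The energy `-V - h W`, corrected by `M h` so that it decreases along orbits. -/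
def orbitEnergy (V W : X → ℝ) (h : ℝ → ℝ) (M : ℝ) (u : ℝ → X) (t : ℝ) : ℝ :=
  -V (u t) - h t * W (u t) + M * h t

/-- The velocity is the gradient of `V + h W`, which yields `-‖v‖²`. The explicit time dependence
leaves `-h' W`, of unknown sign; the correction `M h` turns it into `h' (M - W) ≤ 0`. -/
theorem IsOrbit.isDissipative (hu : IsOrbit j G K h u) (hh : IsSlowDecay h)
    (hV : IsGradient j V G) (hG : Continuous G) (hW : IsGradient j W K) (hK : Continuous K)
    {M : ℝ} (hM : ∀ t, 0 ≤ t → |W (u t)| ≤ M) :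
    IsDissipative (fun t => j (u t)) (fun t => G (u t) + h t • K (u t)) (orbitEnergy V W h M u)
      (fun t => -‖G (u t) + h t • K (u t)‖ ^ 2 + derivWithin h (Ici 0) t * (M - W (u t))) where
  hasDerivAt := hu.equation
  hasDerivAt_energy t ht := by
    have hc : ContinuousAt u t := hu.continuousOn.continuousAt (Ioi_mem_nhds ht)
    have h1 := hV.hasDerivAt_comp hG hc (hu.equation t ht)
    have h2 := hW.hasDerivAt_comp hK hc (hu.equation t ht)
    have h3 := hh.hasDerivAt ht
    refine ((h1.neg.sub (h3.mul h2)).add (h3.const_mul M)).congr_deriv ?_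
    have h4 : ‖G (u t) + h t • K (u t)‖ ^ 2 =
        inner ℝ (G (u t)) (G (u t) + h t • K (u t)) +
          h t * inner ℝ (K (u t)) (G (u t) + h t • K (u t)) := by
      rw [← real_inner_self_eq_norm_sq, inner_add_left, real_inner_smul_left]
    rw [h4]
    ring
  deriv_le t ht := by
    have h1 := (abs_le.1 (hM t ht.le)).2
    have h2 := hh.deriv_neg t ht.le
    have h3 : derivWithin h (Ici 0) t * (M - W (u t)) ≤ 0 :=
      mul_nonpos_of_nonpos_of_nonneg h2.le (by linarith)
    linarith

theorem IsSlowDecay.tendsto_smul {E : Type*} [NormedAddCommGroup E] [NormedSpace ℝ E]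
    (hh : IsSlowDecay h) {g : ℝ → E} {M : ℝ} (hg : ∀ t, 0 ≤ t → ‖g t‖ ≤ M) :
    Tendsto (fun t => h t • g t) atTop (𝓝 0) := by
  have h1 : Tendsto (fun t => h t * M) atTop (𝓝 0) := by
    simpa using hh.tendsto_zero.mul_const M
  refine squeeze_zero_norm' ?_ h1
  filter_upwards [eventually_ge_atTop 0] with t ht
  have := hh.pos t ht
  rw [norm_smul, Real.norm_of_nonneg this.le]
  gcongr
  exact hg t ht

/-- The points of the `ω`-limit set are equilibria on the limiting energy level. -/
theorem IsOrbit.exists_equilibrium_of_mem_omegaLimitSet (hu : IsOrbit j G K h u)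
    (hh : IsSlowDecay h) (hV : IsGradient j V G) (hG : Continuous G) (hW : IsGradient j W K)
    (hK : Continuous K) (hB : IsAdmissibleSet j V W G K B) (huB : ∀ t, 0 ≤ t → u t ∈ B)
    {M : ℝ} (hM : ∀ x ∈ B, |W x| ≤ M) {l : ℝ}
    (hl : Tendsto (orbitEnergy V W h M u) atTop (𝓝 l)) {y : H} (hy : y ∈ omegaLimitSet j u) :
    ∃ x ∈ B, G x = 0 ∧ j x = y ∧ V x = -l := by
  have hd := hu.isDissipative hh hV hG hW hK fun t ht => hM _ (huB t ht)
  obtain ⟨M', hM'⟩ := hB.bounded_gradient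
  obtain ⟨s, hs, hsy⟩ := hy
  -- The orbit is controlled only for nonnegative times, and finitely many `s n` may be negative.
  have hs' : Tendsto (fun n => max (s n) 0) atTop atTop :=
    tendsto_atTop_mono (fun n => le_max_left _ _) hs
  have hsy' : Tendsto (fun n => j (u (max (s n) 0))) atTop (𝓝 y) := by
    refine hsy.congr' ?_
    filter_upwards [hs.eventually_ge_atTop 0] with n hn
    rw [max_eq_left hn]
  obtain ⟨τ, hτs, hτv, hτf⟩ := hd.exists_shift hl hs'
  have hτ0 : ∀ n, 0 ≤ τ n := fun n => (le_max_right _ _).trans (hτs n)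
  have hτ : Tendsto τ atTop atTop := tendsto_atTop_mono hτs hs'
  have hτy : Tendsto (fun n => j (u (τ n))) atTop (𝓝 y) := by
    simpa using hτf.add hsy'
  have hGτ : Tendsto (fun n => G (u (τ n))) atTop (𝓝 0) := by
    have h1 := (hh.tendsto_smul (g := fun t => K (u t)) fun t ht => hM' _ (huB t ht)).comp hτ
    simpa using hτv.sub h1
  have hVlim : Tendsto (fun t => V (u t)) atTop (𝓝 (-l)) := by
    have h1 := hh.tendsto_smul (g := fun t => W (u t)) fun t ht => hM _ (huB t ht)
    have h2 := (hl.neg.sub h1).add (hh.tendsto_zero.const_mul M)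
    simp only [sub_zero, mul_zero, add_zero] at h2
    refine h2.congr fun t => ?_
    simp only [orbitEnergy, smul_eq_mul]
    ring
  obtain ⟨x, n, hn, hx⟩ := hB.exists_subseq (fun n => u (τ n)) (fun n => huB _ (hτ0 n)) hGτ
  refine ⟨x, hB.isClosed.mem_of_tendsto hx (Eventually.of_forall fun i => huB _ (hτ0 _)),
    ?_, ?_, ?_⟩
  · exact tendsto_nhds_unique ((hG.tendsto x).comp hx) (hGτ.comp hn.tendsto_atTop)
  · exact tendsto_nhds_unique ((j.continuous.tendsto x).comp hx) (hτy.comp hn.tendsto_atTop)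
  · exact tendsto_nhds_unique ((hV.continuous.tendsto x).comp hx)
      ((hVlim.comp hτ).comp hn.tendsto_atTop)

/-- Write `G = v - h K`: then `‖G‖² ≤ 2‖v‖² + 2 (h M')²`, with `h² ≤ h(0) h`, and the correction `h
(M - W)` costs at most `2 M h`. -/
theorem orbitEnergy_sub_le {Y : Type*} {V W : Y → ℝ} {G K : Y → H} {u : ℝ → Y}
    (hh : IsSlowDecay h) {M M' C l : ℝ} (hC : 0 ≤ C) {t : ℝ} (ht : 0 ≤ t)
    (hM : |W (u t)| ≤ M) (hM' : ‖K (u t)‖ ≤ M')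
    (hL : |V (u t) + l| ≤ C * ‖G (u t)‖ ^ 2) :
    orbitEnergy V W h M u t - l ≤
      (2 * C + 2 * C * M' ^ 2 * h 0 + 2 * M) * (‖G (u t) + h t • K (u t)‖ ^ 2 + h t) := by
  have hp := hh.pos t ht
  have hp0 := hh.pos 0 le_rfl
  have hM0 : 0 ≤ M := (abs_nonneg _).trans hM
  have hh0 : h t ≤ h 0 := hh.antitoneOn self_mem_Ici ht ht
  set v := G (u t) + h t • K (u t) with hv
  have h1 : ‖G (u t)‖ ≤ ‖v‖ + h t * M' := by
    have h2 : G (u t) = v - h t • K (u t) := by rw [hv, add_sub_cancel_right]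
    rw [h2]
    refine (norm_sub_le _ _).trans ?_
    rw [norm_smul, Real.norm_of_nonneg hp.le]
    gcongr
  have h3 : ‖G (u t)‖ ^ 2 ≤ 2 * ‖v‖ ^ 2 + 2 * (h t * M') ^ 2 := by
    have h4 : ‖G (u t)‖ ^ 2 ≤ (‖v‖ + h t * M') ^ 2 := by gcongr
    linarith [sq_nonneg (‖v‖ - h t * M')]
  have h5 : (h t * M') ^ 2 ≤ M' ^ 2 * h 0 * h t := by
    have h6 : h t * h t ≤ h 0 * h t := by gcongr
    nlinarith [mul_le_mul_of_nonneg_left h6 (sq_nonneg M')]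
  have h7 : C * ‖G (u t)‖ ^ 2 ≤ C * (2 * ‖v‖ ^ 2 + 2 * (M' ^ 2 * h 0 * h t)) := by
    gcongr
    linarith
  have h8 : h t * (M - W (u t)) ≤ h t * (2 * M) := by
    gcongr
    linarith [(abs_le.1 hM).1]
  have h9 : -(V (u t) + l) ≤ C * ‖G (u t)‖ ^ 2 := (neg_le_abs _).trans hL
  have h10 : 0 ≤ 2 * C * h t := by positivity
  have h11 : 0 ≤ (2 * C * M' ^ 2 * h 0 + 2 * M) * ‖v‖ ^ 2 := by positivity
  simp only [orbitEnergy]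
  linarith

theorem omegaLimitSet_nonempty (hB : IsAdmissibleSet j V W G K B)
    (huB : ∀ t, 0 ≤ t → u t ∈ B) : (omegaLimitSet j u).Nonempty := by
  obtain ⟨y, -, n, hn, hy⟩ := hB.isCompact_image.tendsto_subseq (x := fun n : ℕ => j (u n))
    fun n => subset_closure (mem_image_of_mem j (huB n (Nat.cast_nonneg n)))
  exact ⟨y, fun i => (n i : ℝ), tendsto_natCast_atTop_atTop.comp hn.tendsto_atTop, hy⟩

theorem omegaLimitSet_eq_singleton {y : H} (hy : Tendsto (fun t => j (u t)) atTop (𝓝 y)) :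
    omegaLimitSet j u = {y} := by
  ext z
  refine ⟨fun ⟨s, hs, hsz⟩ => tendsto_nhds_unique hsz (hy.comp hs), ?_⟩
  rintro rfl
  exact ⟨fun n => n, tendsto_natCast_atTop_atTop, hy.comp tendsto_natCast_atTop_atTop⟩

/-- An eventual bound by the tails of `√h` extends to all times `t ≥ 1`. -/
theorem IsSlowDecay.exists_tail_bound (hh : IsSlowDecay h) {g : ℝ → ℝ} {M D T : ℝ}
    (hg : ∀ t, 0 ≤ t → g t ≤ M) (hD : 0 ≤ D) (hT : 0 ≤ T)
    (hle : ∀ t, T ≤ t → 1 ≤ t → g t ≤ D * ∫ s in Ioi (t - 1), √(h s)) :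
    ∃ C : ℝ, ∀ t, 1 ≤ t → g t ≤ C * ∫ s in Ioi (t - 1), √(h s) := by
  have hpos := hh.tail_pos hT
  -- For `t ≤ T` the tail from `t - 1` is at least the positive tail from `T`, so the second summand
  -- covers the bound `M`.
  refine ⟨D + |M| / ∫ s in Ioi T, √(h s), fun t ht => ?_⟩
  have htail := IsSlowDecay.tail_nonneg h (t - 1)
  rcases le_total T t with hTt | hTt
  · refine (hle t hTt ht).trans ?_
    gcongr
    exact le_add_of_nonneg_right (by positivity)
  · have h1 : ∫ s in Ioi T, √(h s) ≤ ∫ s in Ioi (t - 1), √(h s) :=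
      hh.tail_anti (by linarith) (by linarith)
    calc g t ≤ |M| := (hg t (by linarith)).trans (le_abs_self M)
      _ = |M| / (∫ s in Ioi T, √(h s)) * ∫ s in Ioi T, √(h s) :=
          (div_mul_cancel₀ _ hpos.ne').symm
      _ ≤ |M| / (∫ s in Ioi T, √(h s)) * ∫ s in Ioi (t - 1), √(h s) := by gcongr
      _ ≤ _ := by gcongr; linarith

/-- Convergence and its rate for an energy gap that is controlled by the velocity near a limit
point. -/
theorem IsDissipative.exists_rate {f v : ℝ → H} {e e' : ℝ → ℝ} (hd : IsDissipative f v e e')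
    (hh : IsSlowDecay h) {l C : ℝ} (hl : ∀ t, 0 < t → l ≤ e t) (hlim : Tendsto e atTop (𝓝 l))
    (hC : 0 < C) {p : H} {s : ℕ → ℝ} (hs : Tendsto s atTop atTop)
    (hsp : Tendsto (fun n => f (s n)) atTop (𝓝 p)) {δ : ℝ} (hδ : 0 < δ)
    (hle : ∀ t, 0 < t → ‖f t - p‖ < δ → e t - l ≤ C * (‖v t‖ ^ 2 + h t))
    {M : ℝ} (hM : ∀ t, 0 ≤ t → ‖f t - p‖ ≤ M) :
    Tendsto f atTop (𝓝 p) ∧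
      ∃ D : ℝ, ∀ t, 1 ≤ t → ‖f t - p‖ ≤ D * ∫ s in Ioi (t - 1), √(h s) := by
  obtain ⟨htend, T, hT, hTle⟩ := hd.tendsto_of_trapping hh hl hlim hC.le hs hsp hδ hle
  obtain ⟨D, T', hD, hTT', hDle⟩ := hd.exists_energy_le hh hl hC hT fun t ht =>
    hle t (hT.trans_le ht) (hTle t ht).1
  refine ⟨htend, hh.exists_tail_bound (D := 1 + 2 * √(2 * C + 1) * √(D + 1)) hM (by positivity)
    (hT.le.trans hTT') fun t ht ht1 => ?_⟩
  have h1 := (hTle t (hTT'.trans ht)).2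
  have h2 : √(e t - l + h t) ≤ √(D + 1) * √(h t) := by
    rw [← Real.sqrt_mul (by linarith)]
    exact Real.sqrt_le_sqrt (by linarith [hDle t ht])
  have h3 : ∫ s in Ioi t, √(h s) ≤ ∫ s in Ioi (t - 1), √(h s) :=
    hh.tail_anti (by linarith) (by linarith)
  calc ‖f t - p‖ ≤ (∫ s in Ioi t, √(h s)) + 2 * √(2 * C + 1) * √(e t - l + h t) := h1
    _ ≤ (∫ s in Ioi (t - 1), √(h s)) +
        2 * √(2 * C + 1) * (√(D + 1) * ∫ s in Ioi (t - 1), √(h s)) := by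
      gcongr
      refine h2.trans ?_
      gcongr
      exact hh.sqrt_le_tail ht1
    _ = _ := by ring

end Orbits

end PerturbedGradient

/-! ### The convergence theorem. -/

open PerturbedGradient in
theorem mainTheorem3 {H X : Type*}
    [NormedAddCommGroup H] [InnerProductSpace ℝ H] [CompleteSpace H]
    [NormedAddCommGroup X] [NormedSpace ℝ X] [CompleteSpace X]
    (j : X →L[ℝ] H) (hj_inj : Function.Injective j) (hj_dense : DenseRange j)
    (hj_compact : IsCompactOperator j)
    (V W : X → ℝ) (V' W' : X → H)
    (hV : IsGradient j V V') (hV' : ContDiff ℝ 1 V')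
    (hW : IsGradient j W W') (hW' : Continuous W')
    (hFred : ∀ ψ ∈ equilibria V', IsFredholmIndexZero (fderiv ℝ V' ψ))
    (hR : ResonanceHypothesis V') :
    (∀ α : ℝ, 2 < α → IsSlowDecay (fun t => (1 + t) ^ (-α))) ∧
    ∀ h : ℝ → ℝ, IsSlowDecay h → ∀ u : ℝ → X, IsOrbit j V' W' h u →
      (IsCompact (closure (u '' Ici 0)) ∨
        (Bornology.IsBounded (u '' Ici 0) ∧ IsCoerciveOnBounded V' ∧
          BoundedOnBounded V ∧ BoundedOnBounded W')) →
      omegaLimitSet j u ⊆ j '' equilibria V' ∧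
      ∃ ψ ∈ equilibria V', omegaLimitSet j u = {j ψ} ∧
        Tendsto (fun t => j (u t)) atTop (𝓝 (j ψ)) ∧
        ((IsBranchingPoint V' ψ ∨ (fderiv ℝ V' ψ).ker = ⊥) →
          ∃ C : ℝ, ∀ t : ℝ, 1 ≤ t →
            ‖j (u t) - j ψ‖ ≤ C * ∫ s in Ioi (t - 1), Real.sqrt (h s)) := by
  refine ⟨fun α hα => isSlowDecay_rpow hα, fun h hh u hu hbdd => ?_⟩
  have hG := hV'.continuous
  set B := closure (u '' Ici 0) with hBdef
  have huB : ∀ t, 0 ≤ t → u t ∈ B := fun t ht => subset_closure (mem_image_of_mem u ht)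
  have hB : IsAdmissibleSet j V W V' W' B := by
    rcases hbdd with hc | ⟨hb, hcoer, hVb, hWb⟩
    · exact isAdmissibleSet_of_isCompact hc hV hW hW'
    · exact isAdmissibleSet_of_isBounded hj_compact hb.closure isClosed_closure hW hcoer hVb hWb
  obtain ⟨M, hM⟩ := hB.bounded_perturbation
  obtain ⟨M', hM'⟩ := hB.bounded_gradient
  obtain ⟨M₀, hM₀⟩ := hB.bounded_energy
  have hd := hu.isDissipative hh hV hG hW hW' fun t ht => hM _ (huB t ht)
  obtain ⟨l, hlim, hl⟩ := hd.exists_tendsto (m := -M₀) fun t ht => by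
    have h1 := (abs_le.1 (hM₀ _ (huB t ht.le))).2
    have h2 := (abs_le.1 (hM _ (huB t ht.le))).2
    have h3 := mul_le_mul_of_nonneg_left h2 (hh.pos t ht.le).le
    simp only [orbitEnergy]
    linarith
  have homega : ∀ y ∈ omegaLimitSet j u, ∃ x ∈ B, V' x = 0 ∧ j x = y ∧ V x = -l := fun y hy =>
    hu.exists_equilibrium_of_mem_omegaLimitSet hh hV hG hW hW' hB huB hM hlim hy
  refine ⟨fun y hy => ?_, ?_⟩
  · obtain ⟨x, -, hx, hxy, -⟩ := homega y hy
    exact ⟨x, hx, hxy⟩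
  obtain ⟨y, hy⟩ := omegaLimitSet_nonempty hB huB
  obtain ⟨ψ, hψB, hψ, rfl, hVψ⟩ := homega y hy
  obtain ⟨s, hs, hsψ⟩ := hy
  suffices hmain : Tendsto (fun t => j (u t)) atTop (𝓝 (j ψ)) ∧
      ((IsBranchingPoint V' ψ ∨ (fderiv ℝ V' ψ).ker = ⊥) →
        ∃ C : ℝ, ∀ t : ℝ, 1 ≤ t →
          ‖j (u t) - j ψ‖ ≤ C * ∫ s in Ioi (t - 1), Real.sqrt (h s)) from
    ⟨ψ, hψ, omegaLimitSet_eq_singleton hmain.1, hmain⟩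
  have hK : ∀ t, 0 ≤ t → j (u t) ∈ closure (j '' B) := fun t ht =>
    subset_closure (mem_image_of_mem j (huB t ht))
  by_cases hcase : IsBranchingPoint V' ψ ∨ (fderiv ℝ V' ψ).ker = ⊥
  · have := (hFred ψ hψ).1.finite_ker
    have hman : (fderiv ℝ V' ψ).ker = ⊥ ∨
        IsLocalManifoldAt (Module.finrank ℝ (fderiv ℝ V' ψ).ker) (equilibria V') ψ := by
      rcases hcase with hbr | hker
      · rcases Nat.eq_zero_or_pos (Module.finrank ℝ (fderiv ℝ V' ψ).ker) with h0 | h0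
        · exact Or.inl (Submodule.finrank_eq_zero.1 h0)
        · exact Or.inr (hR ψ hbr h0)
      · exact Or.inl hker
    obtain ⟨C₀, hC₀, hloc⟩ := hV.lojasiewicz hj_inj hV' hψ (hFred ψ hψ) hman
    obtain ⟨C, hC, δ, hδ, hloj⟩ := hB.lojasiewicz hj_inj hC₀ hloc
    obtain ⟨R, hRb⟩ := isBounded_iff_forall_norm_le.1 hB.isCompact_image.isBounded
    have hM0 : 0 ≤ M := (abs_nonneg _).trans (hM ψ hψB)
    have hp0 := hh.pos 0 le_rfl
    -- The final summand `1` in the constant ensures that it is strictly positive.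
    have hmain := hd.exists_rate hh hl hlim (M := R + R)
      (C := 2 * C + 2 * C * M' ^ 2 * h 0 + 2 * M + 1) (by positivity) hs hsψ hδ
      (fun t ht htδ => ?_) (fun t ht => (norm_sub_le _ _).trans
        (add_le_add (hRb _ (hK t ht)) (hRb _ (subset_closure (mem_image_of_mem j hψB)))))
    · exact ⟨hmain.1, fun _ => hmain.2⟩
    · have h1 := hloj (u t) (huB t ht.le) htδ
      rw [hVψ, sub_neg_eq_add] at h1
      refine (orbitEnergy_sub_le hh hC ht.le (hM _ (huB t ht.le)) (hM' _ (huB t ht.le)) h1).trans ?_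
      have := hh.pos t ht.le
      exact mul_le_mul_of_nonneg_right (by linarith) (by positivity)
  -- Here `ψ` is an isolated equilibrium with nontrivial kernel: convergence follows from isolation,
  -- and no rate is claimed.
  · refine ⟨?_, fun hc => absurd hc hcase⟩
    obtain ⟨r, hr, hiso⟩ := hB.exists_isolated hj_inj
      fun hacc => hcase (Or.inl ⟨hψ, hacc⟩)
    refine tendsto_of_isolated hu.continuousOn_zero hB.isCompact_image hK hs hsψ hr ?_
    intro z s' hs' hsz hzr
    obtain ⟨x, hxB, hx, rfl, -⟩ := homega z ⟨s', hs', hsz⟩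
    rw [hiso x hxB hx (by rwa [← dist_eq_norm]), dist_self]
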